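/- Let $n\ge 2$, let $z_1,\dots,z_n$ be distinct points of $\mathbb{C}$ (the charged particles) carrying charges $a_1,\dots,a_n>0$ with $\sum_{i=1}^n a_i=1$, and let $w_1,\dots,w_{n-1}$ be the equilibrium points of the resulting electrostatic field, that is, the zeros, counted with multiplicity, of $$f(z)=\sum_{i=1}^{n}\frac{a_i}{z-z_i}.$$ For $1\le m\le k$ let $\Pi_{k,m}$ denote the $m$-th elementary symmetric function in $k$ symbols. Then for all integers $k,m$ with $1\le k\le n-1$ and $1\le m\le k$, and all real $\alpha\ge 1$, $$\sum_{1\le r_1<\dots<r_k\le n-1}\left|\Pi_{k,m}(w_{r_1},\dots,w_{r_k})\right|^{\alpha}\le\sum_{1\le s_1<\dots<s_k\le n}\left|\Pi_{k,m}(z_{s_1},\dots,z_{s_k})\right|^{\alpha}.$$ -/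

import Mathlib

/-- The electrostatic force `f(p) = ∑ i, a i / (p - z i)` generated by charges `a i` placed at the
points `z i`. It is only meaningful (and only used) at points `p` off the set of particles. -/
noncomputable def electrostaticForce {n : ℕ} (a : Fin n → ℝ) (z : Fin n → ℂ) (p : ℂ) : ℂ :=
  ∑ i, (a i : ℂ) / (p - z i)

/-- The finite sequence `w` lists the equilibrium points of the field generated by the charges `a i`
at the points `z i`, counted with multiplicity: no term of `w` is a particle (there the force has a
pole), and each `p` that is not a particle occurs in `w` exactly as many times as its order of
vanishing as a zero of the force (in particular zero times if the force does not vanish at `p`). -/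
structure ListsEquilibriumPoints {n N : ℕ} (a : Fin n → ℝ) (z : Fin n → ℂ)
    (w : Fin N → ℂ) : Prop where
  ne_particle : ∀ j i, w j ≠ z i
  order_eq : ∀ p : ℂ, p ∉ Set.range z →
    analyticOrderAt (electrostaticForce a z) p =
      ((Finset.univ.filter fun j => w j = p).card : ℕ∞)

/-- The value `Π_{k,m}(x_{s_1}, …, x_{s_k})` of the `m`-th elementary symmetric function in
`k` symbols at the terms of `x` with indices in the `k`-element set `s = {s_1 < … < s_k}`. -/
noncomputable def elemSymmOn {N : ℕ} (m : ℕ) (x : Fin N → ℂ) (s : Finset (Fin N)) : ℂ :=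
  (s.val.map x).esymm m

open Finset Matrix Polynomial

/-! Put `D = diagonal z` and let `v` be the unit vector with entries `√(a i)`. The compression of
`D` to the orthogonal complement of `v` has characteristic polynomial `∏ (x - z i)` times the force,
so its eigenvalues are the equilibrium points (`charpoly_compression_eval`,
`roots_eq_map_of_listsEquilibriumPoints`). In an orthonormal basis `U` of that complement making `Uᴴ
* D * U` upper triangular, Cauchy–Binet writes each `Π_{k,m}` of diagonal entries as an average of
the `Π_{k,m}` of particles, with weights the squared moduli of `k`-minors of `U`
(`esymm_diag_eq_sum_norm_det_sq_mul_esymm`). For each set of equilibrium points the weights sum to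
1, and for each set of particles to at most 1, so Jensen's inequality for `t ^ α` finishes. -/

/-! ### Cauchy–Binet and sums over `k`-subsets. -/

theorem Matrix.det_mul_eq_sum_prod_mul_det {R ι κ : Type*} [CommRing R] [Fintype ι] [DecidableEq ι] [Fintype κ]
    [DecidableEq κ] (A : Matrix κ ι R) (B : Matrix ι κ R) :
    (A * B).det = ∑ p : κ → ι, (∏ i, A i (p i)) * (B.submatrix p id).det := by
  have h : A * B = fun i => ∑ j, A i j • B j := by
    ext i j
    simp [Matrix.mul_apply]
  rw [h]
  change (detRowAlternating (R := R) (n := κ)).toMultilinearMap _ = _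
  rw [MultilinearMap.map_sum]
  refine sum_congr rfl fun p _ => ?_
  rw [MultilinearMap.map_smul_univ]
  rfl

/-- An injective `p` factors uniquely as an increasing map after a permutation: its range fixes the
former, sorting gives the latter. -/
theorem Fintype.sum_orderEmbedding_comp_perm {M ι : Type*} [AddCommMonoid M] [Fintype ι] [LinearOrder ι]
    {k : ℕ} (F : (Fin k → ι) → M) (hF : ∀ p, ¬ Function.Injective p → F p = 0) :
    ∑ p, F p = ∑ e : Fin k ↪o ι, ∑ σ : Equiv.Perm (Fin k), F (e ∘ σ) := by
  rw [← Fintype.sum_prod_type']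
  symm
  refine Fintype.sum_of_injective (fun x : (Fin k ↪o ι) × Equiv.Perm (Fin k) => x.1 ∘ x.2)
    ?_ _ _ ?_ (fun _ => rfl)
  · rintro ⟨e, σ⟩ ⟨e', σ'⟩ h
    dsimp only at h
    have hr : Set.range e = Set.range e' := by
      have := congrArg Set.range h
      simpa [Set.range_comp] using this
    obtain rfl : e = e' := by
      ext i
      exact congrFun (e.strictMono.range_inj e'.strictMono |>.1 hr) i
    refine Prod.ext rfl (Equiv.ext fun i => e.injective (congrFun h i))
  · intro p hp
    apply hF
    intro hinj
    apply hp
    have hs : StrictMono (p ∘ Tuple.sort p) :=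
      (Tuple.monotone_sort p).strictMono_of_injective (hinj.comp (Tuple.sort p).injective)
    refine ⟨(OrderEmbedding.ofStrictMono _ hs, (Tuple.sort p)⁻¹), ?_⟩
    ext i
    simp

/-- The Cauchy–Binet formula. -/
theorem Matrix.det_mul_eq_sum_orderEmbedding {R ι : Type*} [CommRing R] [Fintype ι] [LinearOrder ι] {k : ℕ}
    (A : Matrix (Fin k) ι R) (B : Matrix ι (Fin k) R) :
    (A * B).det = ∑ e : Fin k ↪o ι, (A.submatrix id e).det * (B.submatrix e id).det := by
  rw [det_mul_eq_sum_prod_mul_det, Fintype.sum_orderEmbedding_comp_perm]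
  · refine sum_congr rfl fun e _ => ?_
    rw [← det_transpose (A.submatrix id e), det_apply' (A.submatrix id e)ᵀ, sum_mul]
    refine sum_congr rfl fun σ _ => ?_
    have : B.submatrix (e ∘ σ) id = (B.submatrix e id).submatrix σ id := rfl
    rw [this, det_permute]
    simp
    ring
  · intro p hp
    obtain ⟨i, j, hij, hne⟩ : ∃ i j, p i = p j ∧ i ≠ j := by
      simpa [Function.Injective] using hp
    rw [det_zero_of_row_eq hne (by ext; simp [hij]), mul_zero]

theorem sum_orderEmbedding_eq_sum_powersetCard {M β ι : Type*} [AddCommMonoid M] [Fintype ι] [LinearOrder ι] (x : ι → β) (k : ℕ)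
    (g : Multiset β → M) :
    ∑ e : Fin k ↪o ι, g (univ.val.map (x ∘ e)) =
      ∑ s ∈ powersetCard k (univ : Finset ι), g (s.val.map x) := by
  refine sum_bij' (fun e _ => univ.map e.toEmbedding)
    (fun s hs => s.orderEmbOfFin (mem_powersetCard.1 hs).2) ?_ ?_ ?_ ?_ ?_
  · intro e _; simp [mem_powersetCard]
  · simp
  · intro e _
    ext i
    refine congrFun ((StrictMono.range_inj (OrderEmbedding.strictMono _) e.strictMono).1 ?_) i
    simp
  · intro s hs
    ext; simp [← SetLike.mem_coe]
  · intro e _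
    simp only [Finset.map_val, Multiset.map_map]
    rfl

theorem sum_powersetCard_eq_sum_multiset {M β ι : Type*} [AddCommMonoid M] [Fintype ι] (x : ι → β) (k : ℕ)
    (g : Multiset β → M) :
    ∑ s ∈ powersetCard k (univ : Finset ι), g (s.val.map x) =
      (((univ.val.map x).powersetCard k).map g).sum := by
  rw [Multiset.powersetCard_map, Multiset.map_map, ← Finset.map_val_val_powersetCard, Multiset.map_map]
  rfl

/-! ### Triangularizing the compression. -/

/-- Schur triangularization built from the last vector backwards. A unit eigenvector `u'` of the
compressed adjoint of `T` on the complement of `u` is orthogonal to `T y` whenever `y` there is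
orthogonal to `u'`; it then plays the role of `u` one dimension lower. -/
theorem exists_orthonormal_compression_triangular (N : ℕ) {E : Type*} [NormedAddCommGroup E]
    [InnerProductSpace ℂ E] [FiniteDimensional ℂ E] (hE : Module.finrank ℂ E = N + 1)
    (T : E →ₗ[ℂ] E) (u : E) (hu : ‖u‖ = 1) :
    ∃ e : Fin (N + 1) → E, Orthonormal ℂ e ∧ e (Fin.last N) = u ∧
      ∀ i j : Fin N, j < i → inner ℂ (e i.castSucc) (T (e j.castSucc)) = 0 := by
  have key : ∀ (N : ℕ) (F : Submodule ℂ E) (hF : Module.finrank ℂ F = N + 1) (u : E)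
      (huF : u ∈ F) (hu : ‖u‖ = 1), ∃ e : Fin (N + 1) → E, (∀ i, e i ∈ F) ∧
      Orthonormal ℂ e ∧ e (Fin.last N) = u ∧
      ∀ i j : Fin N, j < i → inner ℂ (e i.castSucc) (T (e j.castSucc)) = 0 := by
    clear hE u hu
    intro N
    induction N with
    | zero =>
      intro F hF u huF hu
      refine ⟨fun _ => u, fun _ => huF, ?_, rfl, fun i => i.elim0⟩
      exact ⟨fun _ => hu, fun i j h => absurd (Fin.ext (by omega)) h⟩
    | succ N ih =>
      intro F hF u huF hu
      let V : Submodule ℂ E := F ⊓ (ℂ ∙ u)ᗮ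
      have hV : Module.finrank ℂ V = N + 1 := by
        have h := Submodule.finrank_add_inf_finrank_orthogonal (𝕜 := ℂ) (K₁ := ℂ ∙ u) (K₂ := F)
          ((Submodule.span_singleton_le_iff_mem _ _).2 huF)
        rw [finrank_span_singleton (by rintro rfl; simp at hu), hF, inf_comm] at h
        change 1 + Module.finrank ℂ V = _ at h
        omega
      have : Nontrivial V := Module.nontrivial_of_finrank_pos (R := ℂ) (by omega)
      let S : V →ₗ[ℂ] V := V.orthogonalProjectionOnto.toLinearMap ∘ₗ (LinearMap.adjoint T) ∘ₗ V.subtype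
      obtain ⟨c, hc⟩ := Module.End.exists_eigenvalue S
      obtain ⟨y, hy⟩ := hc.exists_hasEigenvector
      have hy0 : ‖y‖ ≠ 0 := norm_ne_zero_iff.2 hy.2
      let u' : V := ((‖y‖⁻¹ : ℝ) : ℂ) • y
      have hu'n : ‖(u' : E)‖ = 1 := by
        change ‖u'‖ = 1
        simp only [u', norm_smul, Complex.norm_real, norm_inv, norm_norm]
        exact inv_mul_cancel₀ hy0
      have hSu' : S u' = c • u' := by
        simp only [u', map_smul, hy.apply_eq_smul]
        exact smul_comm _ _ _
      obtain ⟨e, heV, heo, hel, het⟩ := ih V hV u' u'.2 hu'n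
      have hperp : ∀ i, inner ℂ (e i) u = 0 := fun i =>
        (Submodule.mem_orthogonal_singleton_iff_inner_left).1 (heV i).2
      refine ⟨Fin.snoc (α := fun _ => E) e u, ?_, ?_, by simp, ?_⟩
      · intro i
        induction i using Fin.lastCases with
        | last => simpa using huF
        | cast i => simpa using (heV i).1
      · rw [orthonormal_iff_ite] at heo ⊢
        intro i j
        induction i using Fin.lastCases with
        | last =>
          induction j using Fin.lastCases with
          | last => simp [inner_self_eq_norm_sq_to_K, hu]
          | cast j =>
            simp [Fin.ext_iff, inner_eq_zero_symm.1 (hperp j), j.2.ne']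
        | cast i =>
          induction j using Fin.lastCases with
          | last => simp [hperp, Fin.ext_iff, i.2.ne]
          | cast j => simp [heo]
      · intro i j hij
        simp only [Fin.snoc_castSucc]
        induction j using Fin.lastCases with
        | last => exact absurd (Fin.le_last i) (not_le.2 hij)
        | cast j =>
          induction i using Fin.lastCases with
          | cast i => exact het i j (by simpa using hij)
          | last =>
            rw [hel, ← LinearMap.adjoint_inner_left]
            have h1 : inner ℂ (LinearMap.adjoint T (u' : E)) (e j.castSucc) =
                inner ℂ (S u') (⟨e j.castSucc, heV _⟩ : V) := by
              simp [S]
            rw [h1, hSu', inner_smul_left]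
            have h2 := heo.2 (i := Fin.last N) (j := j.castSucc) (Fin.castSucc_lt_last j).ne'
            dsimp only at h2
            rw [hel] at h2
            rw [Submodule.coe_inner, h2, mul_zero]
  obtain ⟨e, -, h⟩ := key N ⊤ (by simpa using hE) u trivial hu
  exact ⟨e, h⟩

theorem exists_isometry_triangular {N : ℕ} (D : Matrix (Fin (N + 1)) (Fin (N + 1)) ℂ)
    (v : Fin (N + 1) → ℂ) (hv : ∑ i, ‖v i‖ ^ 2 = 1) :
    ∃ U : Matrix (Fin (N + 1)) (Fin N) ℂ, Uᴴ * U = 1 ∧ U * Uᴴ = 1 - vecMulVec v (star v) ∧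
      (Uᴴ * D * U).BlockTriangular id := by
  obtain ⟨e, heo, hel, het⟩ := exists_orthonormal_compression_triangular N
    (E := EuclideanSpace ℂ (Fin (N + 1))) (by simp) (toEuclideanLin D) (WithLp.toLp 2 v)
    (by rw [EuclideanSpace.norm_eq]; simp [hv])
  let W : Matrix (Fin (N + 1)) (Fin (N + 1)) ℂ := of fun i j => e j i
  have hW : Wᴴ * W = 1 := by
    ext i j
    rw [orthonormal_iff_ite] at heo
    simp only [one_apply, ← heo i j, EuclideanSpace.inner_eq_star_dotProduct, dotProduct]
    simp [W, mul_apply, mul_comm]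
  have hW' : W * Wᴴ = 1 := mul_eq_one_comm.1 hW
  refine ⟨W.submatrix id Fin.castSucc, ?_, ?_, ?_⟩
  · ext i j
    have := congrFun (congrFun hW i.castSucc) j.castSucc
    simpa [mul_apply, one_apply] using this
  · rw [← hW']
    ext i j
    simp [mul_apply, Fin.sum_univ_castSucc, vecMulVec_apply, W, hel]
  · intro i j hij
    have := het i j hij
    rw [← this, EuclideanSpace.inner_eq_star_dotProduct, Matrix.mul_assoc]
    simp [mul_apply, W, dotProduct, mulVec, mul_comm, toEuclideanLin]

/-! ### Characteristic polynomial of the compression. -/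

theorem charpoly_compression_eval {N : ℕ} (z v : Fin (N + 1) → ℂ) (hv : ∑ i, v i * star (v i) = 1)
    (U : Matrix (Fin (N + 1)) (Fin N) ℂ) (hU : U * Uᴴ = 1 - vecMulVec v (star v)) (x : ℂ)
    (hx0 : x ≠ 0) (hx : ∀ i, x ≠ z i) :
    (Uᴴ * diagonal z * U).charpoly.eval x =
      (∏ i, (x - z i)) * ∑ i, v i * star (v i) / (x - z i) := by
  have hx' : ∀ i, x - z i ≠ 0 := fun i => sub_ne_zero.2 (hx i)
  -- Swapping the factors costs one factor `x`, cancelled at the end by `hx0`, and leaves a rank-one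
  -- perturbation of `x - D`.
  have h1 := congrArg (eval x) (charpoly_mul_comm_of_le (diagonal z * U) Uᴴ (by simp))
  have hdet : (diagonal fun i => x - z i).det = ∏ i, (x - z i) := det_diagonal
  have hu : IsUnit (diagonal fun i => x - z i).det := by
    rw [hdet, isUnit_iff_ne_zero, prod_ne_zero_iff]
    exact fun i _ => hx' i
  have hinv : (diagonal fun i => x - z i)⁻¹ = diagonal fun i => (x - z i)⁻¹ := by
    refine inv_eq_right_inv ?_
    rw [diagonal_mul_diagonal, ← diagonal_one]
    congr 1
    ext i
    exact mul_inv_cancel₀ (hx' i)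
  rw [Matrix.mul_assoc (diagonal z), hU, Matrix.eval_charpoly, ← Matrix.mul_assoc] at h1
  have h2 : scalar (Fin (N + 1)) x - diagonal z * (1 - vecMulVec v (star v)) =
      (diagonal fun i => x - z i) + replicateCol Unit (fun i => z i * v i) *
        replicateRow Unit (star v) := by
    rw [← vecMulVec_eq]
    ext i j
    by_cases h : i = j
    · subst h
      simp [vecMulVec_apply]
      ring
    · simp [vecMulVec_apply, h]
      ring
  rw [h2, det_add_replicateCol_mul_replicateRow hu, hdet, hinv, det_unique] at h1
  simp only [Fintype.card_fin, add_tsub_cancel_left, pow_one, eval_mul, eval_X] at h1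
  have h3 : ((1 : Matrix Unit Unit ℂ) + replicateRow Unit (star v) * diagonal (fun i => (x - z i)⁻¹) *
      replicateCol Unit (fun i => z i * v i)) default default =
      x * ∑ i, v i * star (v i) / (x - z i) := by
    -- Expanding 1 by `hv` allows `1 + z i / (x - z i) = x / (x - z i)` term by term.
    rw [Matrix.add_apply, Matrix.one_apply_eq, ← hv, mul_apply, ← sum_add_distrib, mul_sum]
    refine sum_congr rfl fun i _ => ?_
    have := hx' i
    simp
    field_simp
    ring
  rw [h3] at h1
  apply mul_left_cancel₀ hx0
  rw [← h1]
  ring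

/-! ### Minors of `U` as weights. -/

theorem sum_norm_det_submatrix_sq_row {ι : Type*} [Fintype ι] [LinearOrder ι] {N k : ℕ}
    (U : Matrix ι (Fin N) ℂ) (hU : Uᴴ * U = 1) (e : Fin k ↪o Fin N) :
    ∑ f : Fin k ↪o ι, ‖(U.submatrix f e).det‖ ^ 2 = 1 := by
  have h := det_mul_eq_sum_orderEmbedding (Uᴴ.submatrix e id) (U.submatrix id e)
  have h1 : Uᴴ.submatrix e id * U.submatrix id e = 1 := by
    rw [← submatrix_mul Uᴴ U e id e Function.bijective_id, hU, submatrix_one _ e.injective]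
  rw [h1, det_one] at h
  have : ((∑ f : Fin k ↪o ι, ‖(U.submatrix f e).det‖ ^ 2 : ℝ) : ℂ) = 1 := by
    rw [h]
    push_cast
    refine sum_congr rfl fun f _ => ?_
    rw [← Complex.conj_mul', starRingEnd_apply, ← det_conjTranspose]
    rfl
  exact_mod_cast this

/-- By Cauchy–Binet the sum is a principal minor of `1 - v vᴴ`, namely `1 - ∑ i, ‖v (f i)‖ ^ 2`. -/
theorem sum_norm_det_submatrix_sq_col_le {n N k : ℕ} (v : Fin n → ℂ)
    (U : Matrix (Fin n) (Fin N) ℂ) (hU : U * Uᴴ = 1 - vecMulVec v (star v)) (f : Fin k ↪o Fin n) :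
    ∑ e : Fin k ↪o Fin N, ‖(U.submatrix f e).det‖ ^ 2 ≤ 1 := by
  have h := det_mul_eq_sum_orderEmbedding (U.submatrix f id) (Uᴴ.submatrix id f)
  have h1 : U.submatrix f id * Uᴴ.submatrix id f =
      1 + replicateCol Unit (fun i => - v (f i)) * replicateRow Unit (fun i => star (v (f i))) := by
    rw [← submatrix_mul U Uᴴ f id f Function.bijective_id, hU]
    ext i j
    simp [one_apply, vecMulVec_apply, mul_apply, sub_eq_add_neg]
  rw [h1, det_one_add_replicateCol_mul_replicateRow] at h
  have : ((∑ e : Fin k ↪o Fin N, ‖(U.submatrix f e).det‖ ^ 2 : ℝ) : ℂ) =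
      ((1 - ∑ i, ‖v (f i)‖ ^ 2 : ℝ) : ℂ) := by
    have h2 : ((1 - ∑ i, ‖v (f i)‖ ^ 2 : ℝ) : ℂ) =
        1 + (fun i => star (v (f i))) ⬝ᵥ (fun i => - v (f i)) := by
      simp [dotProduct, Complex.conj_mul', sub_eq_add_neg]
    rw [h2, h]
    push_cast
    refine sum_congr rfl fun e _ => ?_
    rw [← Complex.mul_conj', starRingEnd_apply, ← det_conjTranspose]
    rfl
  rw [Complex.ofReal_injective this]
  have := sum_nonneg fun i (_ : i ∈ univ) => sq_nonneg ‖v (f i)‖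
  linarith

/-- Cauchy–Binet over `ℂ[X]` expands the principal minor of `X + Uᴴ * D * U` on `e`; triangularity
makes that minor a product over the diagonal. Compare coefficients of `X ^ (k - m)`. -/
theorem esymm_diag_eq_sum_norm_det_sq_mul_esymm {n N k m : ℕ} (hmk : m ≤ k)
    (z : Fin n → ℂ) (U : Matrix (Fin n) (Fin N) ℂ) (hU : Uᴴ * U = 1)
    (hT : (Uᴴ * diagonal z * U).BlockTriangular id) (e : Fin k ↪o Fin N) :
    (univ.val.map ((Uᴴ * diagonal z * U).diag ∘ e)).esymm m =
      ∑ f : Fin k ↪o Fin n, ((‖(U.submatrix f e).det‖ ^ 2 : ℝ) : ℂ) *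
        (univ.val.map (z ∘ f)).esymm m := by
  have coeff_eq : ∀ x : Fin k → ℂ,
      (univ.val.map x).esymm m = (∏ i, (X + C (x i))).coeff (k - m) := by
    intro x
    have := Multiset.prod_X_add_C_coeff' univ.val x (k := k - m) (by simp)
    rw [Finset.prod_eq_multiset_prod, this]
    simp [Nat.sub_sub_self hmk]
  let E : Matrix (Fin n) (Fin n) ℂ[X] := diagonal fun i => X + C (z i)
  have h := det_mul_eq_sum_orderEmbedding ((Uᴴ.map C).submatrix e id) (E * (U.map C).submatrix id e)
  have h1 : (Uᴴ.map C).submatrix e id * (E * (U.map C).submatrix id e) =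
      ((scalar (Fin N) X + (Uᴴ * diagonal z * U).map C).submatrix e e : Matrix _ _ ℂ[X]) := by
    have hE : E = scalar (Fin n) X + (diagonal z).map C := by
      ext1 i j
      by_cases hij : i = j <;> simp [E, hij]
    have h2 : (Uᴴ.map C) * (E * (U.map C)) = scalar (Fin N) X + (Uᴴ * diagonal z * U).map C := by
      rw [hE, Matrix.add_mul, Matrix.mul_add, Matrix.map_mul, Matrix.map_mul, Matrix.mul_assoc]
      congr 1
      rw [scalar_apply, ← smul_eq_diagonal_mul, Matrix.mul_smul, ← Matrix.map_mul, hU,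
        Matrix.map_one _ (map_zero C) (map_one C), smul_one_eq_diagonal, scalar_apply]
    rw [← h2]
    rfl
  have ht : ((scalar (Fin N) X + (Uᴴ * diagonal z * U).map C).submatrix e e :
      Matrix _ _ ℂ[X]).BlockTriangular id := by
    intro i j hij
    have hlt : e j < e i := e.strictMono hij
    simp only [submatrix_apply, Matrix.add_apply, map_apply, hT hlt]
    simp [hlt.ne']
  rw [h1, det_of_isUpperTriangular ht] at h
  rw [coeff_eq]
  have h3 : ∏ i, (X + C (((Uᴴ * diagonal z * U).diag ∘ e) i)) =
      ∏ i, ((scalar (Fin N) X + (Uᴴ * diagonal z * U).map C).submatrix e e : Matrix _ _ ℂ[X]) i i := by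
    refine prod_congr rfl fun i _ => ?_
    simp only [submatrix_apply, Matrix.add_apply, map_apply, scalar_apply, diagonal_apply_eq,
      Function.comp_apply, diag_apply]
  rw [h3, h, finsetSum_coeff]
  refine sum_congr rfl fun f _ => ?_
  rw [coeff_eq, ← coeff_C_mul]
  congr 1
  have h4 : (E * (U.map C).submatrix id e).submatrix f id =
      (diagonal fun i => X + C (z (f i))) * (U.submatrix f e).map C := by
    ext1 i j
    simp [E]
  have h5 : (((Uᴴ.map C).submatrix e id).submatrix id f) = ((U.submatrix f e)ᴴ).map (C : ℂ →+* ℂ[X]) := rfl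
  have h6 : ∀ M : Matrix (Fin k) (Fin k) ℂ, (M.map (C : ℂ →+* ℂ[X])).det = C M.det := fun M =>
    (RingHom.map_det C M).symm
  rw [h4, h5, det_mul, h6, h6, det_diagonal, det_conjTranspose, mul_left_comm, ← C_mul, mul_comm]
  congr 2
  push_cast
  rw [← Complex.conj_mul']
  rfl

/-! ### Equilibrium points as eigenvalues, and the final inequality. -/

theorem roots_eq_map_of_listsEquilibriumPoints {N : ℕ} {a : Fin (N + 1) → ℝ}
    {z : Fin (N + 1) → ℂ} (hz : Function.Injective z) (ha : ∀ i, 0 < a i) {w : Fin N → ℂ}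
    (hw : ListsEquilibriumPoints a z w) {Q : ℂ[X]} (hQ : Q.Monic)
    (hQe : ∀ x, x ≠ 0 → (∀ i, x ≠ z i) →
      Q.eval x = (∏ i, (x - z i)) * electrostaticForce a z x) :
    Q.roots = univ.val.map w := by
  have hforce : ∀ x, (∀ i, x ≠ z i) →
      (∑ i, C (a i : ℂ) * ∏ j ∈ univ.erase i, (X - C (z j))).eval x =
        (∏ i, (x - z i)) * electrostaticForce a z x := by
    intro x hxz
    simp only [electrostaticForce, mul_sum, eval_finsetSum, eval_mul, eval_C, eval_prod, eval_sub,
      eval_X]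
    refine sum_congr rfl fun i _ => ?_
    rw [← mul_prod_erase univ (fun i => x - z i) (mem_univ i)]
    have := sub_ne_zero.2 (hxz i)
    field_simp
  have hpoly : Q = ∑ i, C (a i : ℂ) * ∏ j ∈ univ.erase i, (X - C (z j)) := by
    -- Agreement off a finite set suffices, which also removes the exclusion of 0.
    refine Polynomial.eq_of_infinite_eval_eq _ _ ?_
    refine Set.Infinite.mono ?_ ((Set.finite_range z).insert 0).infinite_compl
    intro x hx
    simp only [Set.mem_compl_iff, Set.mem_insert_iff, Set.mem_range, not_or, not_exists] at hx
    have hxz : ∀ i, x ≠ z i := fun i h => hx.2 i h.symm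
    exact (hQe x hx.1 hxz).trans (hforce x hxz).symm
  have heval : ∀ x, (∀ i, x ≠ z i) →
      Q.eval x = (∏ i, (x - z i)) * electrostaticForce a z x := by
    rwa [hpoly]
  ext p
  rw [count_roots, Multiset.count_map]
  by_cases hp : p ∈ Set.range z
  · obtain ⟨i, rfl⟩ := hp
    rw [Multiset.filter_eq_nil.2 fun j _ h => hw.ne_particle j i h.symm, Multiset.card_zero]
    refine rootMultiplicity_eq_zero ?_
    rw [IsRoot, hpoly, eval_finsetSum, sum_eq_single i]
    · simp only [eval_mul, eval_C, eval_prod, eval_sub, eval_X]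
      refine mul_ne_zero (by exact_mod_cast (ha i).ne') (prod_ne_zero_iff.2 fun j hj => ?_)
      exact sub_ne_zero.2 fun h => (mem_erase.1 hj).1 (hz h.symm)
    · intro j _ hj
      simp only [eval_mul, eval_C, eval_prod, eval_sub, eval_X]
      rw [prod_eq_zero (mem_erase.2 ⟨hj.symm, mem_univ i⟩) (sub_self _), mul_zero]
    · simp
  · have ho := hw.order_eq p hp
    have hpz : ∀ i, p ≠ z i := fun i h => hp ⟨i, h.symm⟩
    have hprod : (∏ i, (p - z i)) ≠ 0 := prod_ne_zero_iff.2 fun i _ => sub_ne_zero.2 (hpz i)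
    obtain ⟨g, hg, hdvd⟩ := exists_eq_pow_rootMultiplicity_mul_and_not_dvd Q hQ.ne_zero p
    have hev : ∀ᶠ x in nhds p, ∀ i, x ≠ z i :=
      Filter.eventually_all.2 fun i => eventually_ne_nhds (hpz i)
    have hpa : AnalyticAt ℂ (fun x => ∏ i, (x - z i)) p := by fun_prop
    have hga : AnalyticAt ℂ (fun x => g.eval x) p := by
      exact AnalyticOnNhd.eval_polynomial g p (Set.mem_univ p)
    have hfa : AnalyticAt ℂ (electrostaticForce a z) p := by
      unfold electrostaticForce
      refine Finset.univ.analyticAt_fun_sum fun i _ => ?_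
      exact analyticAt_const.div (by fun_prop) (sub_ne_zero.2 (hpz i))
    have ho' : analyticOrderAt (electrostaticForce a z) p = (Q.rootMultiplicity p : ℕ∞) := by
      -- Near `p` the force is `Q` over a nonvanishing product, so order equals root multiplicity.
      rw [hfa.analyticOrderAt_eq_natCast]
      refine ⟨fun x => g.eval x / ∏ i, (x - z i), hga.div hpa hprod, ?_, ?_⟩
      · exact div_ne_zero (fun h => hdvd (dvd_iff_isRoot.2 h)) hprod
      · filter_upwards [hev] with x hx
        have h1 := heval x hx
        have h2 : (∏ i, (x - z i)) ≠ 0 := prod_ne_zero_iff.2 fun i _ => sub_ne_zero.2 (hx i)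
        rw [hg] at h1
        simp only [eval_mul, eval_pow, eval_sub, eval_X, eval_C] at h1
        rw [smul_eq_mul, ← mul_div_assoc, h1, mul_div_cancel_left₀ _ h2]
    rw [ho] at ho'
    rw [← ENat.natCast_inj.1 ho']
    simp only [eq_comm (a := p)]
    rfl

theorem sum_norm_elemSymmOn_rpow_le_of_compression {n N k m : ℕ} (hmk : m ≤ k) {α : ℝ} (hα : 1 ≤ α)
    (z v : Fin n → ℂ) (U : Matrix (Fin n) (Fin N) ℂ) (hU : Uᴴ * U = 1)
    (hU' : U * Uᴴ = 1 - vecMulVec v (star v))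
    (hT : (Uᴴ * diagonal z * U).BlockTriangular id) :
    ∑ r ∈ powersetCard k univ, ‖elemSymmOn m (Uᴴ * diagonal z * U).diag r‖ ^ α ≤
      ∑ s ∈ powersetCard k univ, ‖elemSymmOn m z s‖ ^ α := by
  unfold elemSymmOn
  have hα0 : 0 ≤ α := zero_le_one.trans hα
  rw [← sum_orderEmbedding_eq_sum_powersetCard _ k fun s : Multiset ℂ => ‖s.esymm m‖ ^ α,
    ← sum_orderEmbedding_eq_sum_powersetCard _ k fun s : Multiset ℂ => ‖s.esymm m‖ ^ α]
  calc _ ≤ ∑ e : Fin k ↪o Fin N, ∑ f : Fin k ↪o Fin n, ‖(U.submatrix f e).det‖ ^ 2 *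
          ‖(univ.val.map (z ∘ f)).esymm m‖ ^ α := ?_
    _ = ∑ f : Fin k ↪o Fin n, (∑ e : Fin k ↪o Fin N, ‖(U.submatrix f e).det‖ ^ 2) *
          ‖(univ.val.map (z ∘ f)).esymm m‖ ^ α := by
        rw [sum_comm]
        simp only [sum_mul]
    _ ≤ _ := sum_le_sum fun f _ => mul_le_of_le_one_left (by positivity)
        (sum_norm_det_submatrix_sq_col_le v U hU' f)
  refine sum_le_sum fun e _ => ?_
  refine le_trans ?_ (Real.rpow_arith_mean_le_arith_mean_rpow univ _ _ (fun _ _ => by positivity)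
    (sum_norm_det_submatrix_sq_row U hU e) (fun _ _ => norm_nonneg _) hα)
  refine Real.rpow_le_rpow (norm_nonneg _) ?_ hα0
  rw [esymm_diag_eq_sum_norm_det_sq_mul_esymm hmk z U hU hT e]
  refine (norm_sum_le _ _).trans (sum_le_sum fun f _ => ?_)
  rw [norm_mul, Complex.norm_real, Real.norm_of_nonneg (by positivity)]

theorem Matrix.BlockTriangular.roots_charpoly {N : ℕ} {T : Matrix (Fin N) (Fin N) ℂ}
    (hT : T.BlockTriangular id) : T.charpoly.roots = univ.val.map T.diag := by
  have h : T.charpoly = ∏ i, (X - C (T.diag i)) := by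
    have ht : T.charmatrix.BlockTriangular id := by
      intro i j hij
      have : i ≠ j := ne_of_gt hij
      rw [charmatrix_apply_ne _ _ _ this, hT hij, map_zero, neg_zero]
    rw [Matrix.charpoly, det_of_isUpperTriangular ht]
    simp
  have hr := roots_multiset_prod_X_sub_C (univ.val.map T.diag)
  rw [Multiset.map_map] at hr
  rw [h, Finset.prod_eq_multiset_prod]
  exact hr

theorem corollary3p6 (n : ℕ) (hn : 2 ≤ n) (a : Fin n → ℝ) (z : Fin n → ℂ)
    (hz : Function.Injective z) (ha : ∀ i, 0 < a i) (hsum : ∑ i, a i = 1)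
    (w : Fin (n - 1) → ℂ) (hw : ListsEquilibriumPoints a z w)
    (k m : ℕ) (hk : 1 ≤ k) (hkn : k ≤ n - 1) (hm : 1 ≤ m) (hmk : m ≤ k)
    (α : ℝ) (hα : 1 ≤ α) :
    ∑ r ∈ Finset.powersetCard k (Finset.univ : Finset (Fin (n - 1))), ‖elemSymmOn m w r‖ ^ α ≤
      ∑ s ∈ Finset.powersetCard k (Finset.univ : Finset (Fin n)), ‖elemSymmOn m z s‖ ^ α := by
  obtain ⟨N, rfl⟩ : ∃ N, n = N + 1 := ⟨n - 1, by omega⟩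
  simp only [Nat.add_sub_cancel] at w hw ⊢
  let v : Fin (N + 1) → ℂ := fun i => (√(a i) : ℝ)
  have hv : ∀ i, v i * star (v i) = a i := fun i => by
    simp only [v, Complex.star_def, Complex.conj_ofReal]
    exact_mod_cast Real.mul_self_sqrt (ha i).le
  obtain ⟨U, hU, hU', hT⟩ := exists_isometry_triangular (diagonal z) v (by
    rw [← hsum]
    refine sum_congr rfl fun i _ => ?_
    simp only [v, Complex.norm_real, Real.norm_eq_abs, sq_abs]
    exact Real.sq_sqrt (ha i).le)
  have hroots := roots_eq_map_of_listsEquilibriumPoints hz ha hw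
    (charpoly_monic (Uᴴ * diagonal z * U)) fun x hx0 hx => by
      rw [charpoly_compression_eval z v (by simp only [hv]; exact_mod_cast hsum) U hU' x hx0 hx]
      simp only [hv, electrostaticForce]
  rw [hT.roots_charpoly] at hroots
  refine le_trans (le_of_eq ?_) (sum_norm_elemSymmOn_rpow_le_of_compression hmk hα z v U hU hU' hT)
  unfold elemSymmOn
  -- The diagonal and `w` agree only as multisets, so both sums are expressed through the multiset.
  rw [sum_powersetCard_eq_sum_multiset _ k fun s : Multiset ℂ => ‖s.esymm m‖ ^ α,
    sum_powersetCard_eq_sum_multiset _ k fun s : Multiset ℂ => ‖s.esymm m‖ ^ α, hroots]
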